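/- Let $m\ge 1$ and let $\Gamma\subset\mathbb{R}^m\times\mathbb{R}$ be a (full-rank) lattice such that the coordinate projections $p_1:\mathbb{R}^m\times\mathbb{R}\to\mathbb{R}^m$ and $p_2:\mathbb{R}^m\times\mathbb{R}\to\mathbb{R}$ are both injective on $\Gamma$ and have dense images $p_1(\Gamma)\subset\mathbb{R}^m$, $p_2(\Gamma)\subset\mathbb{R}$. Let $\Omega\subset\mathbb{R}$ be a compact interval of positive length, symmetric around the origin, whose boundary contains no point of $p_2(\Gamma)$, and let $$\Lambda(\Omega)=\{p_1(\gamma):\gamma\in\Gamma,\ p_2(\gamma)\in\Omega\}$$ be the corresponding simple generic model set. Then the density $$D(\Lambda(\Omega))=\lim_{R\to\infty}\frac{\#\big(\Lambda(\Omega)\cap(x+R[0,1]^m)\big)}{R^m}$$ exists for every $x\in\mathbb{R}^m$ and does not depend on $x$. Let $\mathcal{K}$ be a countable index set and, for every $k\in\mathcal{K}$, let $g_k:\mathbb{R}^m\to\mathbb{C}$ belong to the Wiener amalgam space $W(L^2,\ell^1)$, i.e. $g_k$ is measurable and $\sum_{n\in\mathbb{Z}^m}\|g_k\mathbf{1}_{n+[0,1]^m}\|_2<\infty$.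 Write $T_\lambda g(t)=g(t-\lambda)$ and $\widehat{g}(t)=\int_{\mathbb{R}^m}g(s)e^{-2\pi i s\cdot t}\,ds$. Then the family $\{T_\lambda g_k:k\in\mathcal{K},\lambda\in\Lambda(\Omega)\}$ is a normalized tight frame for $L^2(\mathbb{R}^m)$, that is, $$\sum_{k\in\mathcal{K}}\sum_{\lambda\in\Lambda(\Omega)}|\langle f,T_\lambda g_k\rangle|^2=\|f\|_2^2\quad\text{for all } f\in L^2(\mathbb{R}^m),$$ if and only if it is a Bessel sequence with upper frame bound $1$, that is, $$\sum_{k\in\mathcal{K}}\sum_{\lambda\in\Lambda(\Omega)}|\langle f,T_\lambda g_k\rangle|^2\le\|f\|_2^2\quad\text{for all } f\in L^2(\mathbb{R}^m),$$ and $$D(\Lambda(\Omega))\sum_{k\in\mathcal{K}}|\widehat{g}_k(t)|^2=1\quad\text{for a.e. } t\in\mathbb{R}^m.$$ -/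

import Mathlib

open MeasureTheory Filter Topology
open scoped ENNReal ComplexConjugate FourierTransform

namespace ModelSetFrames

/-- The axis-parallel cube `R[0,1]^m + x` in `ℝ^m`. -/
def cube {m : ℕ} (x : EuclideanSpace ℝ (Fin m)) (R : ℝ) : Set (EuclideanSpace ℝ (Fin m)) :=
  {y | ∀ i, x i ≤ y i ∧ y i ≤ x i + R}

section ModelSets

variable {E F : Type*} [NormedAddCommGroup E] [NormedSpace ℝ E]
  [NormedAddCommGroup F] [NormedSpace ℝ F]

/-- `Γ` is a (full-rank) lattice in `E × F` such that both coordinate projections are injective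
on `Γ` and map `Γ` onto a dense subgroup. Being a lattice depends only on the topology and the
linear structure of the product, so the choice of norm on `E × F` is irrelevant. -/
structure IsCutAndProjectLattice (Γ : Submodule ℤ (E × F)) : Prop where
  discrete : DiscreteTopology Γ
  span_eq_top : Submodule.span ℝ (Γ : Set (E × F)) = ⊤
  injOn_fst : Set.InjOn Prod.fst (Γ : Set (E × F))
  dense_fst : Dense (Prod.fst '' (Γ : Set (E × F)))
  injOn_snd : Set.InjOn Prod.snd (Γ : Set (E × F))
  dense_snd : Dense (Prod.snd '' (Γ : Set (E × F)))

/-- A window: nonempty, compact, equal to the closure of its interior, with Lebesgue-null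
boundary. -/
structure IsWindow [MeasureSpace F] (Ω : Set F) : Prop where
  nonempty : Ω.Nonempty
  isCompact : IsCompact Ω
  closure_interior : closure (interior Ω) = Ω
  frontier_null : volume (frontier Ω) = 0

/-- The model set `Λ(Ω) = {p₁(γ) : γ ∈ Γ, p₂(γ) ∈ Ω}`. -/
def modelSet (Γ : Submodule ℤ (E × F)) (Ω : Set F) : Set E :=
  {x | ∃ γ ∈ Γ, γ.1 = x ∧ γ.2 ∈ Ω}

/-- `Λ(Ω)` is generic: no point of `p₂(Γ)` lies on the boundary of the window. -/
def IsGeneric (Γ : Submodule ℤ (E × F)) (Ω : Set F) : Prop :=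
  Disjoint (frontier Ω) (Prod.snd '' (Γ : Set (E × F)))

/-- The data `(Γ, Ω)` define a simple model set: the internal space is `ℝ` and the window is
an interval (an order-connected set). -/
structure IsSimple (Γ : Submodule ℤ (E × ℝ)) (Ω : Set ℝ) : Prop where
  lattice : IsCutAndProjectLattice Γ
  window : IsWindow Ω
  interval : Ω.OrdConnected

end ModelSets

section Analysis

variable {m : ℕ}

/-- `Λ ⊆ ℝ^m` has density `D`: for every `x`,
`#(Λ ∩ (R[0,1]^m + x)) / R^m → D` as `R → ∞`. -/
def HasDensity (Λ : Set (EuclideanSpace ℝ (Fin m))) (D : ℝ) : Prop :=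
  ∀ x : EuclideanSpace ℝ (Fin m),
    Tendsto (fun R : ℝ => ((Λ ∩ cube x R).ncard : ℝ) / R ^ m) atTop (𝓝 D)

/-- The density `D(Λ)`, the limit computed with cubes `R[0,1]^m` at the origin. (Its value is
meaningful only when the limit exists; see `HasDensity`.) -/
noncomputable def density (Λ : Set (EuclideanSpace ℝ (Fin m))) : ℝ :=
  limUnder atTop (fun R : ℝ => ((Λ ∩ cube 0 R).ncard : ℝ) / R ^ m)

/-- The Wiener amalgam space `W(L^p, ℓ^1)`: the sum over `n ∈ ℤ^m` of the `L^p` norms of `f`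
restricted to the cubes `[0,1]^m + n` is finite. -/
def MemAmalgamOne (p : ℝ≥0∞) (f : EuclideanSpace ℝ (Fin m) → ℂ) : Prop :=
  AEStronglyMeasurable f volume ∧
    ∑' n : Fin m → ℤ,
      eLpNorm ((cube (WithLp.toLp 2 fun i => (n i : ℝ)) 1).indicator f) p volume < ∞

/-- Translation `T_l f(t) = f(t - l)`. -/
def translate (l : EuclideanSpace ℝ (Fin m)) (f : EuclideanSpace ℝ (Fin m) → ℂ) :
    EuclideanSpace ℝ (Fin m) → ℂ := fun t => f (t - l)

/-- The `L²` pairing `⟨f, h⟩ = ∫ f(t) conj(h(t)) dt`. -/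
noncomputable def pairing (f h : EuclideanSpace ℝ (Fin m) → ℂ) : ℂ :=
  ∫ t, f t * conj (h t)

variable {K : Type*}

/-- `∑_k ∑_{l ∈ Λ} |⟨f, T_l g_k⟩|²`, as an element of `[0, ∞]`. -/
noncomputable def frameSum (g : K → EuclideanSpace ℝ (Fin m) → ℂ)
    (Λ : Set (EuclideanSpace ℝ (Fin m))) (f : EuclideanSpace ℝ (Fin m) → ℂ) : ℝ≥0∞ :=
  ∑' k, ∑' l : Λ, ‖pairing f (translate (l : EuclideanSpace ℝ (Fin m)) (g k))‖ₑ ^ 2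

/-- `{T_l g_k : k ∈ K, l ∈ Λ}` is a Bessel sequence for `L²(ℝ^m)` with upper frame bound `B`. -/
def IsBessel (g : K → EuclideanSpace ℝ (Fin m) → ℂ)
    (Λ : Set (EuclideanSpace ℝ (Fin m))) (B : ℝ) : Prop :=
  ∀ f : EuclideanSpace ℝ (Fin m) → ℂ, MemLp f 2 volume →
    frameSum g Λ f ≤ ENNReal.ofReal B * eLpNorm f 2 volume ^ 2

/-- `{T_l g_k : k ∈ K, l ∈ Λ}` is a frame for `L²(ℝ^m)` with lower and upper frame bounds
`A, B > 0`. -/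
def IsFrame (g : K → EuclideanSpace ℝ (Fin m) → ℂ)
    (Λ : Set (EuclideanSpace ℝ (Fin m))) (A B : ℝ) : Prop :=
  0 < A ∧ 0 < B ∧ IsBessel g Λ B ∧
    ∀ f : EuclideanSpace ℝ (Fin m) → ℂ, MemLp f 2 volume →
      ENNReal.ofReal A * eLpNorm f 2 volume ^ 2 ≤ frameSum g Λ f

/-- A normalized tight frame: a frame with both frame bounds equal to `1`. -/
def IsNormalizedTightFrame (g : K → EuclideanSpace ℝ (Fin m) → ℂ)
    (Λ : Set (EuclideanSpace ℝ (Fin m))) : Prop :=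
  IsFrame g Λ 1 1

end Analysis

end ModelSetFrames

/-! For `f` in `L²` put `energy g f x = ∑_k |⟨f, T_x g_k⟩|²` and periodize `energy g f x * 1_Ω(s)`
over `Γ`. The resulting function `windowSum` on `ℝ^m × ℝ` links the frame to the spectral condition,
because it can be read in two ways.

Pointwise, its value at `(x, p₂(γ₀))` is the frame sum over `Λ(Ω)` of a translate of `f`
(`windowSum_energy_snd`). Since `p₂(Γ)` is dense and a Bessel bound makes the sum continuous in `s`
away from boundary hits (`tendsto_windowSum`), frame inequalities pass to almost every point.

On average, unfolding gives the integral over a fundamental domain `D` as `|Ω| ∫ energy g f`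
(`setLIntegral_windowSum`), and Plancherel turns this into `|Ω| ∫ |φ|² ∑_k |ĝ_k|²` when `f = 𝓕⁻ φ`
(`lintegral_energy_fourierInv`). The density of `Λ(Ω)` is `|Ω| / vol D` (`hasDensity_Icc`), so the
spectral condition says that the mean of `windowSum` is `‖f‖²`.

A tight frame makes `windowSum` equal to `‖f‖²` almost everywhere; taking `φ = 1_B` yields the
condition. Conversely, a function bounded by `‖f‖²` with mean `‖f‖²` equals it almost everywhere,
and genericity lets this equality be carried to the origin, where `windowSum` is the frame sum of
`f`. -/

namespace ModelSetFrames

/-! ### Plancherel for the inverse Fourier integral on `L¹ ∩ L²` -/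

section FourierL2

variable {V : Type*} [NormedAddCommGroup V] [InnerProductSpace ℝ V] [FiniteDimensional ℝ V]
  [MeasurableSpace V] [BorelSpace V]

/-- The inverse Fourier integral is self-adjoint for the bilinear pairing. -/
theorem integral_fourierInv_mul_eq {f h : V → ℂ} (hf : Integrable f) (hh : Integrable h) :
    ∫ x, 𝓕⁻ f x * h x = ∫ x, f x * 𝓕⁻ h x := by
  have key : ∫ x, 𝓕 (fun y => f (-y)) x * h x = ∫ x, f (-x) * 𝓕 h x := by
    simpa using! VectorFourier.integral_fourierIntegral_smul_eq_flip (L := innerₗ V)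
      Real.continuous_fourierChar continuous_inner hf.comp_neg hh
  rw [Real.fourierInv_eq_fourier_comp_neg, key, ← integral_neg_eq_self]
  simp [Real.fourierInv_eq_fourier_neg]

theorem continuous_fourierInv {f : V → ℂ} (hf : Integrable f) : Continuous (𝓕⁻ f) := by
  rw [Real.fourierInv_eq_fourier_comp_neg]
  exact VectorFourier.fourierIntegral_continuous Real.continuous_fourierChar
    (L := innerₗ V) continuous_inner hf.comp_neg

theorem continuous_fourier {f : V → ℂ} (hf : Integrable f) : Continuous (𝓕 f) :=
  VectorFourier.fourierIntegral_continuous Real.continuous_fourierChar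
    (L := innerₗ V) continuous_inner hf

/-- The inverse Fourier integral of `f ∈ L¹ ∩ L²` is the `L²` inverse Fourier transform of `f`. -/
theorem toLp_fourierInv_ae_eq {f : V → ℂ} (hf : Integrable f) (hf2 : MemLp f 2 volume) :
    ((𝓕⁻ (hf2.toLp f) : Lp ℂ 2 (volume : Measure V)) : V → ℂ) =ᵐ[volume] 𝓕⁻ f := by
  refine ae_eq_of_integral_contDiff_smul_eq ?_ ?_ ?_
  · exact (Lp.memLp _).locallyIntegrable (by norm_num)
  · exact (continuous_fourierInv hf).locallyIntegrable
  · intro φ hφ hφc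
    have h1 : HasCompactSupport (fun x => (φ x : ℂ)) := hφc.comp_left (g := Complex.ofReal) rfl
    have h2 : ContDiff ℝ (⊤ : ℕ∞) (fun x => (φ x : ℂ)) := Complex.ofRealCLM.contDiff.comp hφ
    -- Both transforms agree as tempered distributions; pairing with the test function `φ` moves
    -- `𝓕⁻` onto `φ`, where it is the integral transform.
    have e := DFunLike.congr_fun (Lp.fourierInv_toTemperedDistribution_eq (hf2.toLp f))
      (h1.toSchwartzMap h2)
    rw [TemperedDistribution.fourierInv_apply, Lp.toTemperedDistribution_apply,
      Lp.toTemperedDistribution_apply] at e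
    have e1 : ∫ x, (𝓕⁻ (h1.toSchwartzMap h2)) x • (hf2.toLp f : V → ℂ) x
        = ∫ x, 𝓕⁻ (fun x => (φ x : ℂ)) x * f x := by
      refine integral_congr_ae ?_
      filter_upwards [hf2.coeFn_toLp] with x hx
      rw [hx, SchwartzMap.fourierInv_coe]
      rfl
    have hint : Integrable (fun x => (φ x : ℂ)) :=
      h2.continuous.integrable_of_hasCompactSupport h1
    rw [e1, integral_fourierInv_mul_eq hint hf] at e
    simpa using! e.symm

theorem memLp_fourierInv {f : V → ℂ} (hf : Integrable f) (hf2 : MemLp f 2 volume) :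
    MemLp (𝓕⁻ f) 2 volume :=
  (memLp_congr_ae (toLp_fourierInv_ae_eq hf hf2)).1 (Lp.memLp _)

/-- Plancherel's theorem for the inverse Fourier integral of a function in `L¹ ∩ L²`. -/
theorem eLpNorm_fourierInv {f : V → ℂ} (hf : Integrable f) (hf2 : MemLp f 2 volume) :
    eLpNorm (𝓕⁻ f) 2 volume = eLpNorm f 2 volume := by
  rw [← eLpNorm_congr_ae (toLp_fourierInv_ae_eq hf hf2), ← eLpNorm_congr_ae hf2.coeFn_toLp,
    ← Lp.enorm_def, ← Lp.enorm_def, ← ofReal_norm, ← ofReal_norm]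
  congr 1
  rw [← Lp.norm_fourier_eq, FourierTransform.fourier_fourierInv_eq]

theorem eLpNorm_two_sq (f : V → ℂ) : eLpNorm f 2 volume ^ 2 = ∫⁻ x, ‖f x‖ₑ ^ 2 := by
  rw [eLpNorm_eq_lintegral_rpow_enorm_toReal (by norm_num) (by norm_num)]
  simp only [ENNReal.toReal_ofNat, ENNReal.rpow_ofNat]
  rw [← ENNReal.rpow_ofNat, ← ENNReal.rpow_mul]
  simp

theorem fourierInv_conj_comp_sub {g : V → ℂ} (x ξ : V) :
    𝓕⁻ (fun t => conj (g (t - x))) ξ = Real.fourierChar (inner ℝ x ξ) * conj (𝓕 g ξ) := by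
  rw [Real.fourierInv_eq, Real.fourier_eq, ← integral_conj, ← integral_const_mul,
    ← integral_add_right_eq_self _ x]
  refine integral_congr_ae (ae_of_all _ fun t => ?_)
  have h : (inner ℝ (t + x) ξ : ℝ) = inner ℝ x ξ + inner ℝ t ξ := by rw [inner_add_left]; ring
  simp only [Circle.smul_def, smul_eq_mul, map_mul, add_sub_cancel_right, h]
  rw [AddChar.map_add_eq_mul, AddChar.map_neg_eq_inv, ← Circle.coe_inv_eq_conj, inv_inv,
    Circle.coe_mul, mul_assoc]

end FourierL2

/-! ### Pairings with translates on the Fourier side -/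

section Pairing

variable {m : ℕ}

/-- Self-adjointness moves `𝓕⁻` onto the conjugated translate of `g`, where the translation becomes
a character in `x`. Hence the pairing is an inverse Fourier transform in the translation parameter,
which gives its continuity and its `L²` norm. -/
theorem pairing_fourierInv {φ g : EuclideanSpace ℝ (Fin m) → ℂ} (hφ : Integrable φ)
    (hg : Integrable g) (x : EuclideanSpace ℝ (Fin m)) :
    pairing (𝓕⁻ φ) (translate x g) = 𝓕⁻ (fun ξ => φ ξ * conj (𝓕 g ξ)) x := by
  have hh : Integrable (fun t => conj (g (t - x))) :=
    LinearIsometryEquiv.integrable_comp_iff (Complex.conjLIE) |>.2 (hg.comp_sub_right x)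
  simp only [pairing, translate]
  rw [integral_fourierInv_mul_eq hφ hh, Real.fourierInv_eq]
  refine integral_congr_ae (ae_of_all _ fun ξ => ?_)
  simp only [fourierInv_conj_comp_sub, Circle.smul_def, smul_eq_mul]
  rw [real_inner_comm]
  ring

/-- Boundedness of `𝓕 g` and the resulting integrability of `φ · conj (𝓕 g)`. -/
theorem memLp_mul_conj_fourier {p : ℝ≥0∞} {φ g : EuclideanSpace ℝ (Fin m) → ℂ}
    (hφ : MemLp φ p volume) (hg : Integrable g) :
    MemLp (fun ξ => φ ξ * conj (𝓕 g ξ)) p volume := by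
  have hc : Continuous fun ξ => conj (𝓕 g ξ) := Complex.continuous_conj.comp (continuous_fourier hg)
  refine hφ.of_le_mul (c := ∫ t, ‖g t‖) (hφ.1.mul hc.aestronglyMeasurable)
    (ae_of_all _ fun ξ => ?_)
  rw [norm_mul, RCLike.norm_conj, mul_comm]
  gcongr
  exact VectorFourier.norm_fourierIntegral_le_integral_norm _ _ _ _ _

theorem continuous_pairing_fourierInv {φ g : EuclideanSpace ℝ (Fin m) → ℂ} (hφ : Integrable φ)
    (hg : Integrable g) : Continuous fun x => pairing (𝓕⁻ φ) (translate x g) := by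
  simp only [pairing_fourierInv hφ hg]
  exact continuous_fourierInv
    (memLp_one_iff_integrable.1 (memLp_mul_conj_fourier (memLp_one_iff_integrable.2 hφ) hg))

theorem lintegral_pairing_fourierInv {φ g : EuclideanSpace ℝ (Fin m) → ℂ} (hφ : Integrable φ)
    (hφ2 : MemLp φ 2 volume) (hg : Integrable g) :
    ∫⁻ x, ‖pairing (𝓕⁻ φ) (translate x g)‖ₑ ^ 2 = ∫⁻ ξ, ‖φ ξ‖ₑ ^ 2 * ‖𝓕 g ξ‖ₑ ^ 2 := by
  simp only [pairing_fourierInv hφ hg]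
  rw [← eLpNorm_two_sq, eLpNorm_fourierInv _ (memLp_mul_conj_fourier hφ2 hg), eLpNorm_two_sq]
  · simp [mul_pow, enorm_mul]
  · exact memLp_one_iff_integrable.1 (memLp_mul_conj_fourier (memLp_one_iff_integrable.2 hφ) hg)

end Pairing

/-! ### The amalgam space embeds in `L¹` and `L²` -/

section Amalgam

variable {m : ℕ}

theorem iUnion_cube : ⋃ n : Fin m → ℤ,
    cube (WithLp.toLp 2 fun i => (n i : ℝ)) 1 = (Set.univ : Set (EuclideanSpace ℝ (Fin m))) := by
  refine Set.eq_univ_of_forall fun y => Set.mem_iUnion.2 ⟨fun i => ⌊y i⌋, fun i => ?_⟩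
  exact ⟨Int.floor_le _, (Int.lt_floor_add_one _).le⟩

theorem cube_eq_preimage (x : EuclideanSpace ℝ (Fin m)) (R : ℝ) :
    cube x R = (MeasurableEquiv.toLp 2 (Fin m → ℝ)).symm ⁻¹'
      Set.pi Set.univ fun i => Set.Icc (x i) (x i + R) := by
  ext y
  simp [cube, Set.mem_pi, -Set.pi_univ_Icc]

theorem measurableSet_cube (x : EuclideanSpace ℝ (Fin m)) (R : ℝ) : MeasurableSet (cube x R) := by
  rw [cube_eq_preimage]
  exact (MeasurableEquiv.toLp 2 (Fin m → ℝ)).symm.measurable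
    (MeasurableSet.univ_pi fun i => measurableSet_Icc)

theorem volume_cube (x : EuclideanSpace ℝ (Fin m)) (R : ℝ) :
    volume (cube x R) = ENNReal.ofReal R ^ m := by
  rw [cube_eq_preimage, (EuclideanSpace.volume_preserving_symm_measurableEquiv_toLp (Fin m)).measure_preimage
    (MeasurableSet.univ_pi fun i => measurableSet_Icc).nullMeasurableSet, volume_pi_pi]
  simp

theorem tsum_sq_le_sq_tsum {ι : Type*} (a : ι → ℝ≥0∞) : ∑' i, a i ^ 2 ≤ (∑' i, a i) ^ 2 := by
  rw [sq (∑' i, a i), ← ENNReal.tsum_mul_left]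
  refine ENNReal.tsum_le_tsum fun i => ?_
  rw [sq]
  gcongr
  exact ENNReal.le_tsum i

theorem MemAmalgamOne.memLp {g : EuclideanSpace ℝ (Fin m) → ℂ} (hg : MemAmalgamOne 2 g) :
    MemLp g 2 volume := by
  refine ⟨hg.1, ?_⟩
  have h : eLpNorm g 2 volume ^ 2 ≤ (∑' n : Fin m → ℤ,
      eLpNorm ((cube (WithLp.toLp 2 fun i => (n i : ℝ)) 1).indicator g) 2 volume) ^ 2 := by
    refine le_trans ?_ (tsum_sq_le_sq_tsum _)
    rw [eLpNorm_two_sq, ← setLIntegral_univ, ← iUnion_cube]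
    refine (lintegral_iUnion_le _ _).trans (ENNReal.tsum_le_tsum fun n => ?_)
    rw [eLpNorm_two_sq, ← lintegral_indicator (measurableSet_cube _ _)]
    refine lintegral_mono fun x => ?_
    by_cases hx : x ∈ cube (WithLp.toLp 2 fun i => (n i : ℝ)) 1 <;> simp [hx]
  have h' := h.trans_lt (ENNReal.pow_lt_top hg.2)
  by_contra hc
  simp only [not_lt, top_le_iff] at hc
  simp [hc] at h'

/-- Each unit cube has volume one, so Hölder bounds the `L¹` norm there by the `L²` norm with
constant one. -/
theorem MemAmalgamOne.integrable {g : EuclideanSpace ℝ (Fin m) → ℂ} (hg : MemAmalgamOne 2 g) :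
    Integrable g volume := by
  rw [← memLp_one_iff_integrable]
  refine ⟨hg.1, lt_of_le_of_lt ?_ hg.2⟩
  rw [eLpNorm_one_eq_lintegral_enorm, ← setLIntegral_univ, ← iUnion_cube]
  refine (lintegral_iUnion_le _ _).trans (ENNReal.tsum_le_tsum fun n => ?_)
  rw [eLpNorm_indicator_eq_eLpNorm_restrict (measurableSet_cube _ _),
    ← eLpNorm_one_eq_lintegral_enorm]
  refine (eLpNorm_le_eLpNorm_mul_rpow_measure_univ (p := 1) (q := 2) (by norm_num)
    hg.1.restrict).trans ?_
  simp [volume_cube]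

end Amalgam

/-! ### Lattice point counting and the density of model sets -/

section Lattice

variable {m : ℕ} {Γ : Submodule ℤ (EuclideanSpace ℝ (Fin m) × ℝ)}

theorem IsCutAndProjectLattice.countable (h : IsCutAndProjectLattice Γ) : Countable Γ := by
  have := h.discrete
  have : IsZLattice ℝ Γ := ⟨h.span_eq_top⟩
  infer_instance

instance : VAddInvariantMeasure Γ (EuclideanSpace ℝ (Fin m) × ℝ) volume :=
  ⟨fun c s _ => measure_preimage_add (volume.prod volume) (c : EuclideanSpace ℝ (Fin m) × ℝ) s⟩

theorem IsCutAndProjectLattice.exists_fundamentalDomain (h : IsCutAndProjectLattice Γ) :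
    ∃ D : Set (EuclideanSpace ℝ (Fin m) × ℝ), IsAddFundamentalDomain Γ D volume ∧
      MeasurableSet D ∧ Bornology.IsBounded D ∧ volume D ≠ 0 ∧ volume D ≠ ∞ := by
  have := h.discrete
  have : IsZLattice ℝ Γ := ⟨h.span_eq_top⟩
  have := h.countable
  have hD := ZLattice.isAddFundamentalDomain (Module.Free.chooseBasis ℤ Γ)
    (volume : Measure (EuclideanSpace ℝ (Fin m) × ℝ))
  have hb := ZSpan.fundamentalDomain_isBounded ((Module.Free.chooseBasis ℤ Γ).ofZLatticeBasis ℝ)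
  exact ⟨_, hD, ZSpan.fundamentalDomain_measurableSet _, hb, hD.measure_ne_zero (NeZero.ne _), hb.measure_lt_top.ne⟩

/-- Unfolding: integrating a periodization over a fundamental domain. -/
theorem setLIntegral_tsum_vadd [Countable Γ] {D : Set (EuclideanSpace ℝ (Fin m) × ℝ)}
    (hD : IsAddFundamentalDomain Γ D volume) {H : EuclideanSpace ℝ (Fin m) × ℝ → ℝ≥0∞}
    (hH : Measurable H) : ∫⁻ p in D, ∑' γ : Γ, H (γ.1 + p) = ∫⁻ p, H p := by
  rw [hD.lintegral_eq_tsum'', lintegral_tsum]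
  · rfl
  · exact fun γ => (hH.comp (measurable_const_add _)).aemeasurable

theorem tsum_indicator_one_eq_encard {A : Set (EuclideanSpace ℝ (Fin m) × ℝ)}
    (p : EuclideanSpace ℝ (Fin m) × ℝ) :
    ∑' γ : Γ, A.indicator (1 : EuclideanSpace ℝ (Fin m) × ℝ → ℝ≥0∞) (γ.1 + p) = ({γ : Γ | γ.1 + p ∈ A}.encard : ℝ≥0∞) := by
  rw [← ENNReal.tsum_set_one, tsum_subtype (f := fun _ : Γ => (1 : ℝ≥0∞))]
  rfl

theorem setLIntegral_encard [Countable Γ] {D : Set (EuclideanSpace ℝ (Fin m) × ℝ)}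
    (hD : IsAddFundamentalDomain Γ D volume) {A : Set (EuclideanSpace ℝ (Fin m) × ℝ)}
    (hA : MeasurableSet A) :
    ∫⁻ p in D, ({γ : Γ | γ.1 + p ∈ A}.encard : ℝ≥0∞) = volume A := by
  simp only [← tsum_indicator_one_eq_encard]
  rw [setLIntegral_tsum_vadd hD (measurable_one.indicator hA), lintegral_indicator_one hA]

/-- Every point of a bounded set is moved by `Γ` into a fixed box whose internal side is
arbitrarily short. -/
theorem IsCutAndProjectLattice.exists_translate (h : IsCutAndProjectLattice Γ)
    {D : Set (EuclideanSpace ℝ (Fin m) × ℝ)} (hD : Bornology.IsBounded D) {ε : ℝ} (hε : 0 < ε) :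
    ∃ C : ℝ, ∀ d ∈ D, ∃ γ : Γ, |d.2 + γ.1.2| ≤ ε ∧
      ∀ i, |(d.1 + γ.1.1) i| ≤ C := by
  obtain ⟨r, hr⟩ := hD.exists_norm_le
  -- By density of `p₂(Γ)`, `ε`-balls around its points cover `[-r, r]`. Finitely many suffice, and
  -- their physical components determine `C`.
  obtain ⟨T, hT⟩ := (isCompact_Icc (a := -r) (b := r)).elim_finite_subcover
    (fun γ : Γ => Metric.ball (-γ.1.2) ε)
    (fun _ => Metric.isOpen_ball) (fun t _ => by
      obtain ⟨_, hd, γ, hγ, rfl⟩ := Metric.dense_iff.1 h.dense_snd (-t) ε hε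
      refine Set.mem_iUnion.2 ⟨⟨γ, hγ⟩, ?_⟩
      rw [Metric.mem_ball, Real.dist_eq] at hd ⊢
      convert hd using 2
      ring)
  refine ⟨r + ∑ γ ∈ T, ‖γ.1.1‖, fun d hd => ?_⟩
  have h2 : d.2 ∈ Set.Icc (-r) r := abs_le.1 ((norm_snd_le d).trans (hr d hd))
  obtain ⟨γ, hγT, hγ⟩ := Set.mem_iUnion₂.1 (hT h2)
  refine ⟨γ, ?_, fun i => ?_⟩
  · rw [Metric.mem_ball, Real.dist_eq, sub_neg_eq_add] at hγ
    exact hγ.le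
  · refine (PiLp.norm_apply_le (d.1 + γ.1.1) i).trans
      ((norm_add_le _ _).trans (add_le_add ((norm_fst_le d).trans (hr d hd)) ?_))
    exact Finset.single_le_sum (f := fun γ : Γ => ‖γ.1.1‖)
      (fun _ _ => norm_nonneg _) hγT

theorem volume_cube_prod_Icc (x : EuclideanSpace ℝ (Fin m)) (R a b : ℝ) :
    volume (cube x R ×ˢ Set.Icc a b) = ENNReal.ofReal R ^ m * ENNReal.ofReal (b - a) := by
  rw [Measure.volume_eq_prod, Measure.prod_prod, volume_cube, Real.volume_Icc]

/-- The count of `γ` with `γ + d` in a box, integrated over `d ∈ D`, is exactly the volume of the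
box. Moving `d` by a lattice vector into a small box around the origin compares this count with the
one at `d = 0`, after enlarging or shrinking the box. The margin `C` is negligible against `R`; the
internal side does not grow, so its margin `ε` has to be arbitrarily small. -/
theorem IsCutAndProjectLattice.encard_bounds (h : IsCutAndProjectLattice Γ)
    {D : Set (EuclideanSpace ℝ (Fin m) × ℝ)} (hD : IsAddFundamentalDomain Γ D volume)
    (hDm : MeasurableSet D) (hDb : Bornology.IsBounded D) {ε : ℝ} (hε : 0 < ε) :
    ∃ C : ℝ, ∀ (x : EuclideanSpace ℝ (Fin m)) (R a b : ℝ),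
      ({γ : Γ | γ.1 ∈ cube x R ×ˢ Set.Icc a b}.encard : ℝ≥0∞) * volume D ≤
          ENNReal.ofReal (R + 2 * C) ^ m * ENNReal.ofReal (b - a + 2 * ε) ∧
        ENNReal.ofReal (R - 2 * C) ^ m * ENNReal.ofReal (b - a - 2 * ε) ≤
          ({γ : Γ | γ.1 ∈ cube x R ×ˢ Set.Icc a b}.encard : ℝ≥0∞) * volume D := by
  have := h.countable
  obtain ⟨C, hC⟩ := h.exists_translate hDb hε
  refine ⟨C, fun x R a b => ⟨?_, ?_⟩⟩
  · have hv := volume_cube_prod_Icc (x - WithLp.toLp 2 fun _ => C) (R + 2 * C) (a - ε) (b + ε)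
    rw [show b + ε - (a - ε) = b - a + 2 * ε by ring] at hv
    rw [← hv, ← setLIntegral_encard hD ((measurableSet_cube _ _).prod measurableSet_Icc),
      ← setLIntegral_const]
    refine setLIntegral_mono_ae' hDm (ae_of_all _ fun d hd => ?_)
    obtain ⟨γ₀, h1, h2⟩ := hC d hd
    -- `γ + γ₀ + d` differs from `γ` by `d + γ₀`, which lies within the margins.
    have := Set.encard_le_encard_of_injOn (s := {γ : Γ | γ.1 ∈ cube x R ×ˢ Set.Icc a b})
      (t := {γ : Γ | γ.1 + d ∈ cube (x - WithLp.toLp 2 fun _ => C) (R + 2 * C) ×ˢ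
        Set.Icc (a - ε) (b + ε)}) (f := fun γ => γ + γ₀) ?_ (add_left_injective γ₀).injOn
    · exact_mod_cast this
    · rintro γ ⟨hγ1, hγ2⟩
      refine ⟨fun i => ?_, ?_⟩
      · have := abs_le.1 (h2 i)
        have := hγ1 i
        simp at *
        constructor <;> linarith
      · have := abs_le.1 h1
        simp at *
        constructor <;> linarith
  · have hv := volume_cube_prod_Icc (x + WithLp.toLp 2 fun _ => C) (R - 2 * C) (a + ε) (b - ε)
    rw [show b - ε - (a + ε) = b - a - 2 * ε by ring] at hv
    rw [← hv, ← setLIntegral_encard hD ((measurableSet_cube _ _).prod measurableSet_Icc),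
      ← setLIntegral_const]
    refine setLIntegral_mono_ae' hDm (ae_of_all _ fun d hd => ?_)
    obtain ⟨γ₀, h1, h2⟩ := hC d hd
    have := Set.encard_le_encard_of_injOn (t := {γ : Γ | γ.1 ∈ cube x R ×ˢ Set.Icc a b})
      (s := {γ : Γ | γ.1 + d ∈ cube (x + WithLp.toLp 2 fun _ => C) (R - 2 * C) ×ˢ
        Set.Icc (a + ε) (b - ε)}) (f := fun γ => γ - γ₀) ?_ (sub_left_injective).injOn
    · exact_mod_cast this
    · rintro γ ⟨hγ1, hγ2⟩
      refine ⟨fun i => ?_, ?_⟩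
      · have := abs_le.1 (h2 i)
        have := hγ1 i
        simp at *
        constructor <;> linarith
      · have := abs_le.1 h1
        simp at *
        constructor <;> linarith

/-- Injectivity of `p₁` on `Γ` allows counting in the lattice instead. -/
theorem IsCutAndProjectLattice.encard_modelSet_inter (h : IsCutAndProjectLattice Γ) (Ω : Set ℝ)
    (S : Set (EuclideanSpace ℝ (Fin m))) :
    (modelSet Γ Ω ∩ S).encard = {γ : Γ | γ.1 ∈ S ×ˢ Ω}.encard := by
  have hinj : Function.Injective fun γ : Γ => γ.1.1 :=
    fun γ δ hγδ => Subtype.ext (h.injOn_fst γ.2 δ.2 hγδ)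
  rw [← hinj.encard_image]
  congr 1
  ext y
  constructor
  · rintro ⟨⟨γ, hγ, rfl, hΩ⟩, hS⟩
    exact ⟨⟨γ, hγ⟩, ⟨hS, hΩ⟩, rfl⟩
  · rintro ⟨γ, ⟨hS, hΩ⟩, rfl⟩
    exact ⟨⟨γ, γ.2, rfl, hΩ⟩, hS⟩

theorem tendsto_add_div_pow (c : ℝ) (m : ℕ) :
    Tendsto (fun R : ℝ => ((R + c) / R) ^ m) atTop (𝓝 1) := by
  have h : Tendsto (fun R : ℝ => (1 + c / R) ^ m) atTop (𝓝 ((1 + 0) ^ m)) :=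
    ((tendsto_const_nhds.div_atTop tendsto_id).const_add 1).pow m
  rw [add_zero, one_pow] at h
  refine h.congr' ?_
  filter_upwards [eventually_gt_atTop 0] with R hR
  rw [add_div, div_self hR.ne']

/-- The model set with window `[a, b]` has density `(b - a) / covol Γ`. -/
theorem IsCutAndProjectLattice.hasDensity_Icc (h : IsCutAndProjectLattice Γ)
    {D : Set (EuclideanSpace ℝ (Fin m) × ℝ)} (hD : IsAddFundamentalDomain Γ D volume)
    (hDm : MeasurableSet D) (hDb : Bornology.IsBounded D) (hD0 : volume D ≠ 0) (hDt : volume D ≠ ∞) {a b : ℝ}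
    (hab : a < b) :
    HasDensity (modelSet Γ (Set.Icc a b)) ((b - a) / (volume D).toReal) := by
  intro x
  set v := (volume D).toReal with hv
  have hv0 : 0 < v := ENNReal.toReal_pos hD0 hDt
  have hDv : volume D = ENNReal.ofReal v := (ENNReal.ofReal_toReal hDt).symm
  have hcont : ∀ c : ℝ, Tendsto (fun ε : ℝ => (b - a + c * ε) / v) (𝓝[>] 0) (𝓝 ((b - a) / v)) := by
    intro c
    have : Continuous fun ε : ℝ => (b - a + c * ε) / v := by fun_prop
    have := this.tendsto 0
    rw [mul_zero, add_zero] at this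
    exact this.mono_left nhdsWithin_le_nhds
  have hbound : ∀ ε : ℝ, 0 < ε → ∃ C : ℝ, ∀ R : ℝ, 0 < R + 2 * C →
      ((modelSet Γ (Set.Icc a b) ∩ cube x R).ncard : ℝ) * v ≤
          (R + 2 * C) ^ m * (b - a + 2 * ε) ∧
        (0 < R - 2 * C → 0 < b - a - 2 * ε → (R - 2 * C) ^ m * (b - a - 2 * ε) ≤
          ((modelSet Γ (Set.Icc a b) ∩ cube x R).ncard : ℝ) * v) := by
    intro ε hε
    obtain ⟨C, hC⟩ := h.encard_bounds hD hDm hDb hε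
    refine ⟨C, fun R hR => ?_⟩
    obtain ⟨h1, h2⟩ := hC x R a b
    rw [← h.encard_modelSet_inter] at h1 h2
    have hfin : (modelSet Γ (Set.Icc a b) ∩ cube x R).Finite := by
      rw [← Set.encard_ne_top_iff]
      intro htop
      rw [htop] at h1
      simp only [ENat.toENNReal_top, ENNReal.top_mul hD0, top_le_iff] at h1
      exact ENNReal.mul_ne_top (ENNReal.pow_ne_top ENNReal.ofReal_ne_top) ENNReal.ofReal_ne_top h1
    rw [← hfin.cast_ncard_eq, hDv] at h1 h2
    simp only [ENat.toENNReal_coe] at h1 h2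
    rw [← ENNReal.ofReal_natCast, ← ENNReal.ofReal_mul (by positivity)] at h1 h2
    constructor
    · rw [← ENNReal.ofReal_pow hR.le, ← ENNReal.ofReal_mul (by positivity)] at h1
      exact (ENNReal.ofReal_le_ofReal_iff (by have := sub_pos.2 hab; positivity)).1 h1
    · intro h3 h4
      rw [← ENNReal.ofReal_pow h3.le, ← ENNReal.ofReal_mul (by positivity)] at h2
      exact (ENNReal.ofReal_le_ofReal_iff (by positivity)).1 h2
  -- For each target `l`, first fix `ε` so that the perturbed constant is on the correct side of
  -- `l`; only then, with `C` fixed, let `R` grow.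
  refine tendsto_order.2 ⟨fun l hl => ?_, fun l hl => ?_⟩
  · have hev : ∀ᶠ ε in 𝓝[>] (0 : ℝ), 0 < (b - a + (-2) * ε) / v :=
      (tendsto_order.1 (hcont (-2))).1 _ (div_pos (sub_pos.2 hab) hv0)
    obtain ⟨ε, ⟨hε1, hε2⟩, hε⟩ := ((((tendsto_order.1 (hcont (-2))).1 l hl).and hev).and
      self_mem_nhdsWithin).exists
    obtain ⟨C, hC⟩ := hbound ε hε
    have hlim := (tendsto_add_div_pow (-(2 * C)) m).const_mul ((b - a + (-2) * ε) / v)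
    rw [mul_one] at hlim
    filter_upwards [(tendsto_order.1 hlim).1 l hε1, eventually_gt_atTop 0,
      eventually_gt_atTop (2 * C), eventually_gt_atTop (-(2 * C))] with R hR hR0 hR1 hR2
    have hpos : 0 < b - a - 2 * ε := by
      have := (div_pos_iff_of_pos_right hv0).1 hε2
      linarith
    refine hR.trans_le ?_
    rw [div_pow, div_mul_div_comm, div_le_div_iff₀ (by positivity) (by positivity)]
    have := (hC R (by linarith)).2 (by linarith) hpos
    have h' := mul_le_mul_of_nonneg_right this (pow_nonneg hR0.le m)
    calc _ = (R - 2 * C) ^ m * (b - a - 2 * ε) * R ^ m := by ring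
      _ ≤ _ := h'
      _ = _ := by ring
  · obtain ⟨ε, hε1, hε⟩ := (((tendsto_order.1 (hcont 2)).2 l hl).and self_mem_nhdsWithin).exists
    obtain ⟨C, hC⟩ := hbound ε hε
    have hlim := (tendsto_add_div_pow (2 * C) m).const_mul ((b - a + 2 * ε) / v)
    rw [mul_one] at hlim
    filter_upwards [(tendsto_order.1 hlim).2 l hε1, eventually_gt_atTop 0,
      eventually_gt_atTop (-(2 * C))] with R hR hR0 hR2
    refine lt_of_le_of_lt ?_ hR
    rw [div_pow, div_mul_div_comm, div_le_div_iff₀ (by positivity) (by positivity)]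
    have h' := mul_le_mul_of_nonneg_right (hC R (by linarith)).1 (pow_nonneg hR0.le m)
    calc _ = ((modelSet Γ (Set.Icc a b) ∩ cube x R).ncard : ℝ) * v * R ^ m := by ring
      _ ≤ _ := h'
      _ = _ := by ring

theorem HasDensity.density_eq {Λ : Set (EuclideanSpace ℝ (Fin m))} {d : ℝ} (h : HasDensity Λ d) :
    density Λ = d :=
  (h 0).limUnder_eq

end Lattice

/-! ### Periodization over `Γ` and its continuity in the internal variable -/

section WindowSum

variable {m : ℕ} {Γ : Submodule ℤ (EuclideanSpace ℝ (Fin m) × ℝ)}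

/-- The `Γ`-periodization at `p` of the function `(x, s) ↦ c x * 1_Ω s`. -/
noncomputable def windowSum (Γ : Submodule ℤ (EuclideanSpace ℝ (Fin m) × ℝ)) (Ω : Set ℝ)
    (c : EuclideanSpace ℝ (Fin m) → ℝ≥0∞) (p : EuclideanSpace ℝ (Fin m) × ℝ) : ℝ≥0∞ :=
  ∑' γ : Γ, c (γ.1 + p).1 * Ω.indicator 1 (γ.1 + p).2

theorem windowSum_vadd (Ω : Set ℝ) (c : EuclideanSpace ℝ (Fin m) → ℝ≥0∞) (γ₀ : Γ)
    (p : EuclideanSpace ℝ (Fin m) × ℝ) :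
    windowSum Γ Ω c (γ₀.1 + p) = windowSum Γ Ω c p := by
  unfold windowSum
  rw [← (Equiv.addRight γ₀).tsum_eq fun γ : Γ => c (γ.1 + p).1 * Ω.indicator 1 (γ.1 + p).2]
  simp only [Equiv.coe_addRight, Submodule.coe_add, add_assoc]

theorem setLIntegral_windowSum [Countable Γ] {D : Set (EuclideanSpace ℝ (Fin m) × ℝ)}
    (hD : IsAddFundamentalDomain Γ D volume) {Ω : Set ℝ} (hΩ : MeasurableSet Ω)
    {c : EuclideanSpace ℝ (Fin m) → ℝ≥0∞} (hc : Measurable c) :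
    ∫⁻ p in D, windowSum Γ Ω c p = (∫⁻ x, c x) * volume Ω := by
  have hm : Measurable (Ω.indicator (1 : ℝ → ℝ≥0∞)) := measurable_one.indicator hΩ
  have hH : Measurable fun q : EuclideanSpace ℝ (Fin m) × ℝ => c q.1 * Ω.indicator 1 q.2 :=
    (hc.comp measurable_fst).mul (hm.comp measurable_snd)
  refine (setLIntegral_tsum_vadd hD hH).trans ?_
  rw [Measure.volume_eq_prod, lintegral_prod_mul hc.aemeasurable hm.aemeasurable,
    lintegral_indicator_one hΩ]

/-- A bound for the translates by `p₂(Γ)` of the window controls arbitrary bounded windows. -/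
theorem IsCutAndProjectLattice.tsum_Icc_ne_top (h : IsCutAndProjectLattice Γ) {Ω : Set ℝ}
    (hΩ : (interior Ω).Nonempty) {c : EuclideanSpace ℝ (Fin m) → ℝ≥0∞}
    {x : EuclideanSpace ℝ (Fin m)} {B : ℝ≥0∞} (hB : B ≠ ∞)
    (hc : ∀ γ₀ : Γ, windowSum Γ Ω c (x, γ₀.1.2) ≤ B) (ρ : ℝ) :
    ∑' γ : Γ, c (γ.1.1 + x) * (Set.Icc (-ρ) ρ).indicator 1 γ.1.2 ≠ ∞ := by
  -- Density of `p₂(Γ)` lets translates of `interior Ω` cover `[-ρ, ρ]`; a finite subcover bounds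
  -- the sum by finitely many window sums.
  obtain ⟨T, hT⟩ := (isCompact_Icc (a := -ρ) (b := ρ)).elim_finite_subcover
    (fun γ : Γ => (fun u => u + γ.1.2) ⁻¹' interior Ω)
    (fun γ => isOpen_interior.preimage (continuous_add_const _)) (fun t _ => by
      obtain ⟨_, hd, γ, hγ, rfl⟩ := h.dense_snd.inter_open_nonempty
        ((fun u => t + u) ⁻¹' interior Ω) (isOpen_interior.preimage (continuous_const_add _))
        (hΩ.imp' (fun u => u - t) fun u hu => by simpa using hu)
      exact Set.mem_iUnion.2 ⟨⟨γ, hγ⟩, hd⟩)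
  have hle : ∑' γ : Γ, c (γ.1.1 + x) * (Set.Icc (-ρ) ρ).indicator 1 γ.1.2 ≤
      ∑ γ₀ ∈ T, windowSum Γ Ω c (x, γ₀.1.2) := by
    unfold windowSum
    rw [← Summable.tsum_finsetSum fun _ _ => ENNReal.summable]
    refine ENNReal.tsum_le_tsum fun γ => ?_
    by_cases hγ : γ.1.2 ∈ Set.Icc (-ρ) ρ
    · obtain ⟨γ₀, hγ₀, hmem⟩ := Set.mem_iUnion₂.1 (hT hγ)
      refine le_trans ?_ (Finset.single_le_sum (f := fun γ₀ : Γ =>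
        c (γ.1 + (x, γ₀.1.2)).1 * Ω.indicator 1 (γ.1 + (x, γ₀.1.2)).2) (fun _ _ => zero_le) hγ₀)
      have : γ.1.2 + γ₀.1.2 ∈ Ω := interior_subset hmem
      simp [hγ, this]
    · simp [hγ]
  refine (hle.trans_lt ?_).ne
  refine (Finset.sum_le_sum fun γ₀ _ => hc γ₀).trans_lt ?_
  rw [Finset.sum_const, nsmul_eq_mul]
  exact ENNReal.mul_lt_top (ENNReal.natCast_lt_top T.card) hB.lt_top

/-- The window sum is continuous in the internal variable wherever no point of `p₂(Γ)` meets
the boundary of the shifted window. -/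
theorem IsCutAndProjectLattice.tendsto_windowSum (h : IsCutAndProjectLattice Γ) {Ω : Set ℝ}
    (hΩ : (interior Ω).Nonempty) (hΩb : Bornology.IsBounded Ω)
    {c : EuclideanSpace ℝ (Fin m) → ℝ≥0∞} {x : EuclideanSpace ℝ (Fin m)} {B : ℝ≥0∞} (hB : B ≠ ∞)
    (hc : ∀ γ₀ : Γ, windowSum Γ Ω c (x, γ₀.1.2) ≤ B) {s : ℝ}
    (hs : ∀ γ : Γ, γ.1.2 + s ∉ frontier Ω) :
    Tendsto (fun s' => windowSum Γ Ω c (x, s')) (𝓝 s) (𝓝 (windowSum Γ Ω c (x, s))) := by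
  have := h.countable
  obtain ⟨r, hr⟩ := hΩb.exists_norm_le
  simp only [windowSum, ← lintegral_count]
  -- Dominated convergence for counting measure on `Γ`. For `|s' - s| < 1`, a lattice point
  -- contributes only if its internal coordinate has modulus at most `r + |s| + 1`, which gives the
  -- majorant.
  refine tendsto_lintegral_filter_of_dominated_convergence
    (fun γ : Γ => c (γ.1.1 + x) * (Set.Icc (-(r + (|s| + 1))) (r + (|s| + 1))).indicator 1 γ.1.2)
    (Eventually.of_forall fun _ => measurable_of_countable _) ?_ ?_ ?_
  · filter_upwards [Metric.ball_mem_nhds s one_pos] with s' hs'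
    refine ae_of_all _ fun γ => ?_
    by_cases hγ : γ.1.2 + s' ∈ Ω
    · have h1 := abs_le.1 (hr _ hγ)
      have h2 := abs_lt.1 (Metric.mem_ball.1 hs')
      have h3 := neg_abs_le s
      have h4 := le_abs_self s
      have : γ.1.2 ∈ Set.Icc (-(r + (|s| + 1))) (r + (|s| + 1)) :=
        ⟨by linarith, by linarith⟩
      rw [Set.indicator_of_mem this]
      simp [hγ]
    · simp [hγ]
  · rw [lintegral_count]
    exact h.tsum_Icc_ne_top hΩ hB hc _
  · refine ae_of_all _ fun γ => ?_
    have hcont : Tendsto (fun s' => γ.1.2 + s') (𝓝 s) (𝓝 (γ.1.2 + s)) :=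
      (continuous_const_add _).tendsto _
    refine tendsto_const_nhds.congr' ?_
    by_cases hγ : γ.1.2 + s ∈ Ω
    · have hi : γ.1.2 + s ∈ interior Ω := by
        by_contra hni
        exact hs γ ⟨subset_closure hγ, hni⟩
      filter_upwards [hcont (isOpen_interior.mem_nhds hi)] with s' hs'
      have : γ.1.2 + s' ∈ Ω := interior_subset hs'
      simp [hγ, this]
    · have hi : γ.1.2 + s ∈ (closure Ω)ᶜ := fun hcl => hs γ ⟨hcl, fun hi => hγ (interior_subset hi)⟩
      filter_upwards [hcont (isClosed_closure.isOpen_compl.mem_nhds hi)] with s' hs'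
      have : γ.1.2 + s' ∉ Ω := fun hm => hs' (subset_closure hm)
      simp [hγ, this]

theorem IsCutAndProjectLattice.nhdsWithin_neBot (h : IsCutAndProjectLattice Γ) (s : ℝ) :
    (𝓝[Prod.snd '' (Γ : Set (EuclideanSpace ℝ (Fin m) × ℝ))] s).NeBot :=
  mem_closure_iff_nhdsWithin_neBot.1 (h.dense_snd s)

/-- Approach `s` through the dense set `p₂(Γ)` and use continuity at `s`. -/
theorem IsCutAndProjectLattice.windowSum_le (h : IsCutAndProjectLattice Γ) {Ω : Set ℝ}
    (hΩ : (interior Ω).Nonempty) (hΩb : Bornology.IsBounded Ω)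
    {c : EuclideanSpace ℝ (Fin m) → ℝ≥0∞} {x : EuclideanSpace ℝ (Fin m)} {B : ℝ≥0∞} (hB : B ≠ ∞)
    (hc : ∀ γ₀ : Γ, windowSum Γ Ω c (x, γ₀.1.2) ≤ B) {s : ℝ}
    (hs : ∀ γ : Γ, γ.1.2 + s ∉ frontier Ω) : windowSum Γ Ω c (x, s) ≤ B := by
  have hne := h.nhdsWithin_neBot s
  have ht := (h.tendsto_windowSum hΩ hΩb hB hc hs).mono_left
    (nhdsWithin_le_nhds (s := Prod.snd '' (Γ : Set (EuclideanSpace ℝ (Fin m) × ℝ))))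
  refine le_of_tendsto ht ?_
  filter_upwards [self_mem_nhdsWithin] with _ hs'
  obtain ⟨γ, hγ, rfl⟩ := hs'
  exact hc ⟨γ, hγ⟩

theorem IsCutAndProjectLattice.windowSum_eq (h : IsCutAndProjectLattice Γ) {Ω : Set ℝ}
    (hΩ : (interior Ω).Nonempty) (hΩb : Bornology.IsBounded Ω)
    {c : EuclideanSpace ℝ (Fin m) → ℝ≥0∞} {x : EuclideanSpace ℝ (Fin m)} {B : ℝ≥0∞} (hB : B ≠ ∞)
    (hc : ∀ γ₀ : Γ, windowSum Γ Ω c (x, γ₀.1.2) = B) {s : ℝ}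
    (hs : ∀ γ : Γ, γ.1.2 + s ∉ frontier Ω) : windowSum Γ Ω c (x, s) = B := by
  have hne := h.nhdsWithin_neBot s
  have ht := (h.tendsto_windowSum hΩ hΩb hB (fun γ => (hc γ).le) hs).mono_left
    (nhdsWithin_le_nhds (s := Prod.snd '' (Γ : Set (EuclideanSpace ℝ (Fin m) × ℝ))))
  refine tendsto_nhds_unique_of_eventuallyEq ht (tendsto_const_nhds (x := B)) ?_
  filter_upwards [self_mem_nhdsWithin] with _ hs'
  obtain ⟨γ, hγ, rfl⟩ := hs'
  exact hc ⟨γ, hγ⟩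

theorem ae_forall_notMem_frontier [Countable Γ] {Ω : Set ℝ} (hΩ : volume (frontier Ω) = 0) :
    ∀ᵐ p : EuclideanSpace ℝ (Fin m) × ℝ, ∀ γ : Γ, γ.1.2 + p.2 ∉ frontier Ω := by
  have h1 : ∀ᵐ s : ℝ, ∀ γ : Γ, γ.1.2 + s ∉ frontier Ω := by
    refine ae_all_iff.2 fun γ => ?_
    rw [ae_iff]
    simp only [not_not]
    exact (measure_preimage_add volume γ.1.2 (frontier Ω)).trans hΩ
  exact Measure.quasiMeasurePreserving_snd.ae h1

end WindowSum

/-! ### Frame sums as window sums; stability under perturbation of `f` -/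

section FrameSum

variable {m : ℕ} {Γ : Submodule ℤ (EuclideanSpace ℝ (Fin m) × ℝ)} {K : Type*}
  {g : K → EuclideanSpace ℝ (Fin m) → ℂ}

/-- The energy `∑_k |⟨f, T_x g_k⟩|²`. -/
noncomputable def energy (g : K → EuclideanSpace ℝ (Fin m) → ℂ) (f : EuclideanSpace ℝ (Fin m) → ℂ)
    (x : EuclideanSpace ℝ (Fin m)) : ℝ≥0∞ :=
  ∑' k, ‖pairing f (translate x (g k))‖ₑ ^ 2

theorem pairing_translate_add (f h : EuclideanSpace ℝ (Fin m) → ℂ)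
    (x y : EuclideanSpace ℝ (Fin m)) :
    pairing f (translate (y + x) h) = pairing (translate (-x) f) (translate y h) := by
  unfold pairing translate
  rw [← integral_add_right_eq_self _ x]
  simp [sub_add_eq_sub_sub, add_sub_right_comm]

/-- Window sums of the energy are frame sums over model sets with a shifted window. -/
theorem IsCutAndProjectLattice.windowSum_energy (h : IsCutAndProjectLattice Γ) (Ω : Set ℝ)
    (f : EuclideanSpace ℝ (Fin m) → ℂ) (p : EuclideanSpace ℝ (Fin m) × ℝ) :
    windowSum Γ Ω (energy g f) p =
      frameSum g (modelSet Γ ((fun u => u + p.2) ⁻¹' Ω)) (translate (-p.1) f) := by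
  have hΛ : modelSet Γ ((fun u => u + p.2) ⁻¹' Ω) =
      (fun γ : Γ => γ.1.1) '' {γ : Γ | γ.1.2 + p.2 ∈ Ω} := by
    ext y
    constructor
    · rintro ⟨γ, hγ, rfl, hΩ⟩
      exact ⟨⟨γ, hγ⟩, hΩ, rfl⟩
    · rintro ⟨γ, hΩ, rfl⟩
      exact ⟨γ, γ.2, rfl, hΩ⟩
  have hinj : Set.InjOn (fun γ : Γ => γ.1.1) {γ : Γ | γ.1.2 + p.2 ∈ Ω} :=
    fun γ _ δ _ hγδ => Subtype.ext (h.injOn_fst γ.2 δ.2 hγδ)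
  rw [frameSum, ENNReal.tsum_comm, hΛ, tsum_image
    (fun y => ∑' k, ‖pairing (translate (-p.1) f) (translate y (g k))‖ₑ ^ 2) hinj,
    tsum_subtype {γ : Γ | γ.1.2 + p.2 ∈ Ω}
      (fun γ => ∑' k, ‖pairing (translate (-p.1) f) (translate γ.1.1 (g k))‖ₑ ^ 2)]
  refine tsum_congr fun γ => ?_
  by_cases hγ : γ.1.2 + p.2 ∈ Ω
  · simp [hγ, energy, pairing_translate_add]
  · simp [hγ]

theorem translate_zero (f : EuclideanSpace ℝ (Fin m) → ℂ) : translate 0 f = f := by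
  ext t
  simp [translate]

/-- Periodicity replaces `(x, p₂(γ₀))` by `(x - p₁(γ₀), 0)`: the window returns to `Ω` at the price
of translating `f`. -/
theorem IsCutAndProjectLattice.windowSum_energy_snd (h : IsCutAndProjectLattice Γ) (Ω : Set ℝ)
    (f : EuclideanSpace ℝ (Fin m) → ℂ) (x : EuclideanSpace ℝ (Fin m)) (γ₀ : Γ) :
    windowSum Γ Ω (energy g f) (x, γ₀.1.2) =
      frameSum g (modelSet Γ Ω) (translate (-(x - γ₀.1.1)) f) := by
  have e : (x, γ₀.1.2) = γ₀.1 + (x - γ₀.1.1, 0) := by ext <;> simp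
  rw [e, windowSum_vadd, h.windowSum_energy]
  simp

theorem eLpNorm_translate {f : EuclideanSpace ℝ (Fin m) → ℂ} (hf : MemLp f 2 volume)
    (x : EuclideanSpace ℝ (Fin m)) : eLpNorm (translate x f) 2 volume = eLpNorm f 2 volume :=
  eLpNorm_comp_measurePreserving hf.1 (measurePreserving_sub_right volume x)

theorem memLp_translate {f : EuclideanSpace ℝ (Fin m) → ℂ} (hf : MemLp f 2 volume)
    (x : EuclideanSpace ℝ (Fin m)) : MemLp (translate x f) 2 volume :=
  hf.comp_measurePreserving (measurePreserving_sub_right volume x)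

theorem enorm_add_sq_le (a b : ℂ) {ε : ℝ} (hε : 0 < ε) :
    ‖a + b‖ₑ ^ 2 ≤ ENNReal.ofReal (1 + ε) * ‖a‖ₑ ^ 2 + ENNReal.ofReal (1 + ε⁻¹) * ‖b‖ₑ ^ 2 := by
  simp only [← ofReal_norm]
  rw [← ENNReal.ofReal_pow (norm_nonneg _), ← ENNReal.ofReal_pow (norm_nonneg _),
    ← ENNReal.ofReal_pow (norm_nonneg _), ← ENNReal.ofReal_mul (by positivity),
    ← ENNReal.ofReal_mul (by positivity), ← ENNReal.ofReal_add (by positivity) (by positivity)]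
  refine ENNReal.ofReal_le_ofReal ?_
  have h1 : ‖a + b‖ ^ 2 ≤ (‖a‖ + ‖b‖) ^ 2 := by gcongr; exact norm_add_le _ _
  -- Young's inequality `2‖a‖‖b‖ ≤ ε‖a‖² + ε⁻¹‖b‖²`; the factor on the main term tends to one with
  -- `ε`.
  have h2 : 0 ≤ ε⁻¹ * (ε * ‖a‖ - ‖b‖) ^ 2 := by positivity
  have h3 : ε⁻¹ * (ε * ‖a‖ - ‖b‖) ^ 2 = ε * ‖a‖ ^ 2 - 2 * ‖a‖ * ‖b‖ + ε⁻¹ * ‖b‖ ^ 2 := by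
    field_simp
    ring
  nlinarith

theorem pairing_add {f h e : EuclideanSpace ℝ (Fin m) → ℂ} (hf : MemLp f 2 volume)
    (hh : MemLp h 2 volume) (he : MemLp e 2 volume) :
    pairing (f + h) e = pairing f e + pairing h e := by
  have he' : MemLp (fun t => conj (e t)) 2 volume :=
    he.of_le (Complex.continuous_conj.comp_aestronglyMeasurable he.1)
      (ae_of_all _ fun t => by simp)
  unfold pairing
  simp only [Pi.add_apply, add_mul]
  exact integral_add (hf.integrable_mul he') (hh.integrable_mul he')

theorem frameSum_add_le (hg : ∀ k, MemLp (g k) 2 volume) (Λ : Set (EuclideanSpace ℝ (Fin m)))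
    {f h : EuclideanSpace ℝ (Fin m) → ℂ} (hf : MemLp f 2 volume) (hh : MemLp h 2 volume) {ε : ℝ}
    (hε : 0 < ε) : frameSum g Λ (f + h) ≤
      ENNReal.ofReal (1 + ε) * frameSum g Λ f + ENNReal.ofReal (1 + ε⁻¹) * frameSum g Λ h := by
  simp only [frameSum, ← ENNReal.tsum_mul_left, ← ENNReal.tsum_add]
  refine ENNReal.tsum_le_tsum fun k => ENNReal.tsum_le_tsum fun l => ?_
  rw [pairing_add hf hh (memLp_translate (hg k) l)]
  exact enorm_add_sq_le _ _ hε

/-- Passing to the limit in the quadratic triangle inequality. -/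
theorem le_of_tendsto_of_forall_le {ι : Type*} {l : Filter ι} [l.NeBot] {b c d : ι → ℝ≥0∞}
    {b₀ c₀ : ℝ≥0∞} (hb : Tendsto b l (𝓝 b₀)) (hc : Tendsto c l (𝓝 c₀)) (hd : Tendsto d l (𝓝 0))
    (hle : ∀ ε : ℝ, 0 < ε → ∀ᶠ i in l,
      b i ≤ ENNReal.ofReal (1 + ε) * c i + ENNReal.ofReal (1 + ε⁻¹) * d i) : b₀ ≤ c₀ := by
  have h1 : ∀ ε : ℝ, 0 < ε → b₀ ≤ ENNReal.ofReal (1 + ε) * c₀ := by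
    intro ε hε
    have ht := (ENNReal.Tendsto.const_mul hc (a := ENNReal.ofReal (1 + ε))
      (Or.inr ENNReal.ofReal_ne_top)).add (ENNReal.Tendsto.const_mul hd
        (a := ENNReal.ofReal (1 + ε⁻¹)) (Or.inr ENNReal.ofReal_ne_top))
    rw [mul_zero, add_zero] at ht
    exact le_of_tendsto_of_tendsto hb ht (hle ε hε)
  have h2 : Tendsto (fun ε : ℝ => ENNReal.ofReal (1 + ε)) (𝓝[>] 0) (𝓝 1) := by
    have : Continuous fun ε : ℝ => ENNReal.ofReal (1 + ε) :=
      ENNReal.continuous_ofReal.comp (continuous_const_add 1)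
    have := this.tendsto 0
    rw [add_zero, ENNReal.ofReal_one] at this
    exact this.mono_left nhdsWithin_le_nhds
  have h3 := ENNReal.Tendsto.mul_const (b := c₀) h2 (Or.inl one_ne_zero)
  rw [one_mul] at h3
  exact ge_of_tendsto h3 (eventually_nhdsWithin_of_forall fun ε hε => h1 ε hε)

theorem tendsto_eLpNorm_translate_sub {f : EuclideanSpace ℝ (Fin m) → ℂ} (hf : MemLp f 2 volume) :
    Tendsto (fun x => eLpNorm (translate (-x) f - f) 2 volume) (𝓝 0) (𝓝 0) := by
  have : Fact ((2 : ℝ≥0∞) ≠ ∞) := ⟨by norm_num⟩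
  have hc : Continuous fun x : EuclideanSpace ℝ (Fin m) =>
      edist (DomAddAct.mk x +ᵥ hf.toLp f) (hf.toLp f) := by
    refine Continuous.edist ?_ continuous_const
    exact (DomAddAct.continuous_mk).vadd continuous_const
  have h0 := hc.tendsto 0
  have hz : edist (DomAddAct.mk (0 : EuclideanSpace ℝ (Fin m)) +ᵥ hf.toLp f) (hf.toLp f) = 0 := by
    rw [DomAddAct.mk_zero, zero_vadd, edist_self]
  rw [hz] at h0
  refine h0.congr fun x => ?_
  rw [DomAddAct.mk_vadd_toLp, Lp.edist_toLp_toLp]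
  congr 1
  ext t
  simp [translate, add_comm]

end FrameSum

/-! ### The two implications -/

section Main

variable {m : ℕ} {Γ : Submodule ℤ (EuclideanSpace ℝ (Fin m) × ℝ)} {K : Type*}
  {g : K → EuclideanSpace ℝ (Fin m) → ℂ} {Ω : Set ℝ}

/-- A one-point interval is excluded because it is not the closure of its empty interior. -/
theorem IsSimple.exists_eq_Icc (h : IsSimple Γ Ω) : ∃ a b : ℝ, a < b ∧ Ω = Set.Icc a b := by
  have hconn : IsConnected Ω := ⟨h.window.nonempty, h.interval.isPreconnected⟩
  have e := eq_Icc_of_connected_compact hconn h.window.isCompact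
  refine ⟨sInf Ω, sSup Ω, ?_, e⟩
  by_contra hlt
  have hcl := h.window.closure_interior
  have hne := h.window.nonempty
  rw [e, interior_Icc, Set.Ioo_eq_empty hlt, closure_empty] at hcl
  rw [e, ← hcl] at hne
  exact Set.not_nonempty_empty hne

theorem IsWindow.interior_nonempty (h : IsWindow Ω) : (interior Ω).Nonempty := by
  rw [← closure_nonempty_iff, h.closure_interior]
  exact h.nonempty

theorem measurable_energy_fourierInv [Countable K] {φ : EuclideanSpace ℝ (Fin m) → ℂ}
    (hφ : Integrable φ) (hg : ∀ k, Integrable (g k)) : Measurable (energy g (𝓕⁻ φ)) :=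
  Measurable.tsum fun k =>
    (continuous_pairing_fourierInv hφ (hg k)).enorm.measurable.pow_const 2

theorem measurable_tsum_fourier [Countable K] (hg : ∀ k, Integrable (g k)) :
    Measurable fun ξ => ∑' k, ‖𝓕 (g k) ξ‖ₑ ^ 2 :=
  Measurable.tsum fun k => (continuous_fourier (hg k)).enorm.measurable.pow_const 2

/-- The total energy of `𝓕⁻ φ` in terms of the spectral density `∑_k |ĝ_k|²`. -/
theorem lintegral_energy_fourierInv [Countable K] {φ : EuclideanSpace ℝ (Fin m) → ℂ}
    (hφ : Integrable φ) (hφ2 : MemLp φ 2 volume) (hg : ∀ k, Integrable (g k)) :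
    ∫⁻ x, energy g (𝓕⁻ φ) x = ∫⁻ ξ, ‖φ ξ‖ₑ ^ 2 * ∑' k, ‖𝓕 (g k) ξ‖ₑ ^ 2 := by
  unfold energy
  rw [lintegral_tsum fun k =>
    ((continuous_pairing_fourierInv hφ (hg k)).enorm.measurable.pow_const 2).aemeasurable]
  simp only [lintegral_pairing_fourierInv hφ hφ2 (hg _), ← ENNReal.tsum_mul_left]
  rw [lintegral_tsum fun k => ?_]
  exact (hφ2.1.aemeasurable.enorm.pow_const 2).mul
    ((continuous_fourier (hg k)).enorm.measurable.pow_const 2).aemeasurable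

theorem IsBessel.frameSum_le {Λ : Set (EuclideanSpace ℝ (Fin m))} (h : IsBessel g Λ 1)
    {f : EuclideanSpace ℝ (Fin m) → ℂ} (hf : MemLp f 2 volume) :
    frameSum g Λ f ≤ eLpNorm f 2 volume ^ 2 := by
  simpa using h f hf

theorem IsBessel.windowSum_le (hΓ : IsCutAndProjectLattice Γ)
    (h : IsBessel g (modelSet Γ Ω) 1) {f : EuclideanSpace ℝ (Fin m) → ℂ} (hf : MemLp f 2 volume)
    (x : EuclideanSpace ℝ (Fin m)) (γ₀ : Γ) :
    windowSum Γ Ω (energy g f) (x, γ₀.1.2) ≤ eLpNorm f 2 volume ^ 2 := by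
  rw [hΓ.windowSum_energy_snd, ← eLpNorm_translate hf]
  exact h.frameSum_le (memLp_translate hf _)

/-- A Bessel bound for the model set passes to model sets with shifted window. -/
theorem IsBessel.windowSum_le_of_generic (hΓ : IsCutAndProjectLattice Γ) (hΩ : IsWindow Ω)
    (h : IsBessel g (modelSet Γ Ω) 1) {f : EuclideanSpace ℝ (Fin m) → ℂ} (hf : MemLp f 2 volume)
    (x : EuclideanSpace ℝ (Fin m)) {s : ℝ} (hs : ∀ γ : Γ, γ.1.2 + s ∉ frontier Ω) :
    windowSum Γ Ω (energy g f) (x, s) ≤ eLpNorm f 2 volume ^ 2 :=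
  hΓ.windowSum_le hΩ.interior_nonempty hΩ.isCompact.isBounded (ENNReal.pow_ne_top hf.2.ne)
    (h.windowSum_le hΓ hf x) hs

theorem IsBessel.frameSum_shift_le (hΓ : IsCutAndProjectLattice Γ) (hΩ : IsWindow Ω)
    (h : IsBessel g (modelSet Γ Ω) 1) {f : EuclideanSpace ℝ (Fin m) → ℂ} (hf : MemLp f 2 volume)
    {s : ℝ} (hs : ∀ γ : Γ, γ.1.2 + s ∉ frontier Ω) :
    frameSum g (modelSet Γ ((fun u => u + s) ⁻¹' Ω)) f ≤ eLpNorm f 2 volume ^ 2 := by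
  have := h.windowSum_le_of_generic hΓ hΩ hf 0 hs
  rwa [hΓ.windowSum_energy, neg_zero, translate_zero] at this

/-- If the window sums attain the Bessel bound almost everywhere and `0` is a generic point, then
the bound is attained at `0`. -/
theorem IsBessel.le_frameSum (hΓ : IsCutAndProjectLattice Γ) (hΩ : IsWindow Ω)
    (hgen : IsGeneric Γ Ω) (hg : ∀ k, MemLp (g k) 2 volume)
    (h : IsBessel g (modelSet Γ Ω) 1) {f : EuclideanSpace ℝ (Fin m) → ℂ} (hf : MemLp f 2 volume)
    (hae : ∀ᵐ p, windowSum Γ Ω (energy g f) p = eLpNorm f 2 volume ^ 2) :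
    eLpNorm f 2 volume ^ 2 ≤ frameSum g (modelSet Γ Ω) f := by
  have := hΓ.countable
  -- Genericity says exactly that `s = 0` is an admissible continuity point.
  have hgen0 : ∀ γ : Γ, γ.1.2 + 0 ∉ frontier Ω := fun γ hγ =>
    Set.disjoint_left.1 hgen (by simpa using hγ) ⟨γ, γ.2, rfl⟩
  have hdense := Measure.dense_of_ae (hae.and (ae_forall_notMem_frontier (Γ := Γ) hΩ.frontier_null))
  set G := {p : EuclideanSpace ℝ (Fin m) × ℝ | windowSum Γ Ω (energy g f) p =
    eLpNorm f 2 volume ^ 2 ∧ ∀ γ : Γ, γ.1.2 + p.2 ∉ frontier Ω} with hG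
  have hne : (𝓝[G] (0 : EuclideanSpace ℝ (Fin m) × ℝ)).NeBot :=
    mem_closure_iff_nhdsWithin_neBot.1 (hdense 0)
  have hfst : Tendsto Prod.fst (𝓝[G] (0 : EuclideanSpace ℝ (Fin m) × ℝ)) (𝓝 0) :=
    (continuous_fst.tendsto (0 : EuclideanSpace ℝ (Fin m) × ℝ)).mono_left nhdsWithin_le_nhds
  have hsnd : Tendsto Prod.snd (𝓝[G] (0 : EuclideanSpace ℝ (Fin m) × ℝ)) (𝓝 0) :=
    (continuous_snd.tendsto (0 : EuclideanSpace ℝ (Fin m) × ℝ)).mono_left nhdsWithin_le_nhds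
  have hc := (hΓ.tendsto_windowSum hΩ.interior_nonempty hΩ.isCompact.isBounded
    (ENNReal.pow_ne_top hf.2.ne) (h.windowSum_le hΓ hf 0) hgen0).comp hsnd
  have hd := (ENNReal.Tendsto.pow (n := 2) (tendsto_eLpNorm_translate_sub hf)).comp hfst
  rw [zero_pow two_ne_zero] at hd
  -- Along `G` the internal and physical variables are handled separately: continuity of `windowSum`
  -- in `s`, and `L²` continuity of translation in `x`. The error is controlled by the Bessel bound
  -- for the shifted window.
  have key := le_of_tendsto_of_forall_le (tendsto_const_nhds (x := eLpNorm f 2 volume ^ 2)) hc hd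
    fun ε hε => ?_
  · rw [hΓ.windowSum_energy] at key
    simpa [translate_zero] using key
  · filter_upwards [self_mem_nhdsWithin] with p hp
    have hsub : MemLp (translate (-p.1) f - f) 2 volume := (memLp_translate hf _).sub hf
    rw [← hp.1, hΓ.windowSum_energy]
    have := frameSum_add_le hg (modelSet Γ ((fun u => u + p.2) ⁻¹' Ω)) hf hsub hε
    rw [add_sub_cancel] at this
    refine this.trans (add_le_add ?_ ?_)
    · simp only [Function.comp_apply, hΓ.windowSum_energy, neg_zero, translate_zero]
      rfl
    · gcongr
      exact h.frameSum_shift_le hΓ hΩ hsub hp.2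

/-- For a Bessel sequence, an attained mean forces the window sums to attain the bound. -/
theorem IsBessel.ae_windowSum_eq (hΓ : IsCutAndProjectLattice Γ) (hΩ : IsWindow Ω)
    (h : IsBessel g (modelSet Γ Ω) 1) {f : EuclideanSpace ℝ (Fin m) → ℂ} (hf : MemLp f 2 volume)
    {D : Set (EuclideanSpace ℝ (Fin m) × ℝ)} (hD : IsAddFundamentalDomain Γ D volume)
    (hDt : volume D ≠ ∞)
    (hmean : ∫⁻ p in D, windowSum Γ Ω (energy g f) p = eLpNorm f 2 volume ^ 2 * volume D) :
    ∀ᵐ p, windowSum Γ Ω (energy g f) p = eLpNorm f 2 volume ^ 2 := by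
  have := hΓ.countable
  have hle : ∀ᵐ p, windowSum Γ Ω (energy g f) p ≤ eLpNorm f 2 volume ^ 2 := by
    filter_upwards [ae_forall_notMem_frontier (Γ := Γ) hΩ.frontier_null] with p hp
    exact h.windowSum_le_of_generic hΓ hΩ hf p.1 hp
  have hB : eLpNorm f 2 volume ^ 2 ≠ ∞ := ENNReal.pow_ne_top hf.2.ne
  have hae : ∀ᵐ p ∂volume.restrict D, windowSum Γ Ω (energy g f) p = eLpNorm f 2 volume ^ 2 := by
    refine ae_eq_of_ae_le_of_lintegral_le (ae_restrict_of_ae hle) ?_ aemeasurable_const ?_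
    · rw [hmean]
      exact ENNReal.mul_ne_top hB hDt
    · rw [hmean, setLIntegral_const]
  rw [ae_iff]
  -- The exceptional set is `Γ`-invariant, so being null in `D` makes it null.
  refine hD.measure_zero_of_invariant _ (fun γ => ?_) ?_
  · ext p
    rw [Set.mem_vadd_set_iff_neg_vadd_mem]
    change windowSum Γ Ω (energy g f) ((-γ : Γ).1 + p) ≠ _ ↔ windowSum Γ Ω (energy g f) p ≠ _
    rw [windowSum_vadd]
  · rwa [ae_iff, Measure.restrict_apply₀' hD.nullMeasurableSet] at hae

/-- A lower frame bound for Schwartz functions extends to `L²`. -/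
theorem IsBessel.le_frameSum_of_schwartz (hg : ∀ k, MemLp (g k) 2 volume)
    {Λ : Set (EuclideanSpace ℝ (Fin m))} (h : IsBessel g Λ 1)
    (hS : ∀ ψ : SchwartzMap (EuclideanSpace ℝ (Fin m)) ℂ,
      eLpNorm ψ 2 volume ^ 2 ≤ frameSum g Λ ψ)
    {f : EuclideanSpace ℝ (Fin m) → ℂ} (hf : MemLp f 2 volume) :
    eLpNorm f 2 volume ^ 2 ≤ frameSum g Λ f := by
  have hdr := SchwartzMap.denseRange_toLpCLM (E := EuclideanSpace ℝ (Fin m)) (F := ℂ) (p := 2)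
    (μ := volume) ENNReal.ofNat_ne_top
  have hne : (comap (SchwartzMap.toLpCLM ℝ ℂ 2 volume) (𝓝 (hf.toLp f))).NeBot :=
    comap_neBot fun t ht => by
      obtain ⟨_, h1, ψ, rfl⟩ := mem_closure_iff_nhds.1 (hdr (hf.toLp f)) t ht
      exact ⟨ψ, h1⟩
  have ht : Tendsto (fun ψ : SchwartzMap (EuclideanSpace ℝ (Fin m)) ℂ => ψ.toLp 2 volume)
    (comap (SchwartzMap.toLpCLM ℝ ℂ 2 volume) (𝓝 (hf.toLp f))) (𝓝 (hf.toLp f)) := tendsto_comap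
  have hmem : ∀ ψ : SchwartzMap (EuclideanSpace ℝ (Fin m)) ℂ, MemLp ψ 2 volume :=
    fun ψ => ψ.memLp 2 volume
  have hb : Tendsto (fun ψ : SchwartzMap (EuclideanSpace ℝ (Fin m)) ℂ =>
      eLpNorm ψ 2 volume ^ 2) (comap (SchwartzMap.toLpCLM ℝ ℂ 2 volume) (𝓝 (hf.toLp f)))
      (𝓝 (eLpNorm f 2 volume ^ 2)) := by
    have := ENNReal.Tendsto.pow (n := 2) ht.enorm
    rw [Lp.enorm_toLp] at this
    refine this.congr fun ψ => ?_
    exact congrArg (· ^ 2) (Lp.enorm_toLp (hmem ψ))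
  have hd : Tendsto (fun ψ : SchwartzMap (EuclideanSpace ℝ (Fin m)) ℂ =>
      eLpNorm (⇑ψ - f) 2 volume ^ 2) (comap (SchwartzMap.toLpCLM ℝ ℂ 2 volume) (𝓝 (hf.toLp f)))
      (𝓝 0) := by
    have := ENNReal.Tendsto.pow (n := 2) (ht.edist tendsto_const_nhds (b := hf.toLp f))
    rw [edist_self, zero_pow two_ne_zero] at this
    refine this.congr fun ψ => ?_
    exact congrArg (· ^ 2) (Lp.edist_toLp_toLp (ψ : EuclideanSpace ℝ (Fin m) → ℂ) f (hmem ψ) hf)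
  refine le_of_tendsto_of_forall_le hb tendsto_const_nhds hd fun ε hε =>
    Eventually.of_forall fun ψ => (hS ψ).trans ?_
  have hsub : MemLp (⇑ψ - f) 2 volume := (hmem ψ).sub hf
  have := frameSum_add_le hg Λ hf hsub hε
  rw [add_sub_cancel] at this
  refine this.trans ?_
  gcongr
  exact h.frameSum_le hsub

/-- Necessity: a normalized tight frame has constant spectral density. -/
theorem IsNormalizedTightFrame.ae_tsum_fourier_eq [Countable K] (hΓ : IsCutAndProjectLattice Γ)
    (hΩ : IsWindow Ω) (hg : ∀ k, Integrable (g k))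
    (h : IsNormalizedTightFrame g (modelSet Γ Ω)) {D : Set (EuclideanSpace ℝ (Fin m) × ℝ)}
    (hD : IsAddFundamentalDomain Γ D volume) :
    ∀ᵐ ξ, volume Ω * ∑' k, ‖𝓕 (g k) ξ‖ₑ ^ 2 = volume D := by
  have := hΓ.countable
  obtain ⟨-, -, hB, hL⟩ := h
  have hmean : ∀ f : EuclideanSpace ℝ (Fin m) → ℂ, MemLp f 2 volume →
      ∫⁻ p in D, windowSum Γ Ω (energy g f) p = eLpNorm f 2 volume ^ 2 * volume D := by
    intro f hf
    rw [← setLIntegral_const]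
    refine lintegral_congr_ae (ae_restrict_of_ae ?_)
    filter_upwards [ae_forall_notMem_frontier (Γ := Γ) hΩ.frontier_null] with p hp
    refine hΓ.windowSum_eq hΩ.interior_nonempty hΩ.isCompact.isBounded
      (ENNReal.pow_ne_top hf.2.ne) (fun γ₀ => ?_) hp
    refine le_antisymm (hB.windowSum_le hΓ hf _ _) ?_
    rw [hΓ.windowSum_energy_snd, ← eLpNorm_translate hf (-(p.1 - γ₀.1.1))]
    simpa using hL _ (memLp_translate hf (-(p.1 - γ₀.1.1)))
  refine ae_eq_of_forall_setLIntegral_eq_of_sigmaFinite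
    -- Test on sets `B` of finite measure through `f = 𝓕⁻ 1_B`, for which the mean formula reads off
    -- the integral of the spectral density over `B`.
    ((measurable_tsum_fourier hg).const_mul _) measurable_const fun B hBm hBt => ?_
  have hφ2 : MemLp (B.indicator (1 : EuclideanSpace ℝ (Fin m) → ℂ)) 2 volume :=
    memLp_indicator_const 2 hBm 1 (Or.inr hBt.ne)
  have hφ : Integrable (B.indicator (1 : EuclideanSpace ℝ (Fin m) → ℂ)) volume :=
    memLp_one_iff_integrable.1 (memLp_indicator_const 1 hBm 1 (Or.inr hBt.ne))
  have hm := hmean _ (memLp_fourierInv hφ hφ2)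
  rw [setLIntegral_windowSum hD hΩ.isCompact.measurableSet (measurable_energy_fourierInv hφ hg),
    lintegral_energy_fourierInv hφ hφ2 hg, eLpNorm_fourierInv hφ hφ2, eLpNorm_two_sq] at hm
  have e1 : ∀ u : EuclideanSpace ℝ (Fin m) → ℝ≥0∞,
      ∫⁻ ξ, ‖B.indicator (1 : EuclideanSpace ℝ (Fin m) → ℂ) ξ‖ₑ ^ 2 * u ξ = ∫⁻ ξ in B, u ξ := by
    intro u
    rw [← lintegral_indicator hBm]
    refine lintegral_congr fun ξ => ?_
    by_cases hξ : ξ ∈ B <;> simp [hξ]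
  have e2 := e1 1
  simp only [Pi.one_apply, mul_one, lintegral_one, Measure.restrict_apply_univ] at e2
  rw [e1, e2] at hm
  rw [lintegral_const_mul _ (measurable_tsum_fourier hg), setLIntegral_const, mul_comm, hm,
    mul_comm]

/-- Sufficiency: a Bessel sequence with the right spectral density is a normalized tight frame. -/
theorem IsBessel.isNormalizedTightFrame [Countable K] (hΓ : IsCutAndProjectLattice Γ)
    (hΩ : IsWindow Ω) (hgen : IsGeneric Γ Ω) (hg : ∀ k, Integrable (g k))
    (hg2 : ∀ k, MemLp (g k) 2 volume) (h : IsBessel g (modelSet Γ Ω) 1)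
    {D : Set (EuclideanSpace ℝ (Fin m) × ℝ)} (hD : IsAddFundamentalDomain Γ D volume)
    (hDt : volume D ≠ ∞) (hae : ∀ᵐ ξ, volume Ω * ∑' k, ‖𝓕 (g k) ξ‖ₑ ^ 2 = volume D) :
    IsNormalizedTightFrame g (modelSet Γ Ω) := by
  have := hΓ.countable
  refine ⟨one_pos, one_pos, h, fun f hf => ?_⟩
  rw [ENNReal.ofReal_one, one_mul]
  refine h.le_frameSum_of_schwartz hg2 (fun ψ => ?_) hf
  -- The mean formula needs `φ` in `L¹ ∩ L²`; Schwartz functions provide this, hence the reduction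
  -- by density.
  obtain ⟨φ, hψ⟩ : ∃ φ : SchwartzMap (EuclideanSpace ℝ (Fin m)) ℂ, 𝓕⁻ (φ : _ → ℂ) = ψ :=
    ⟨𝓕 ψ, by rw [← SchwartzMap.fourierInv_coe, FourierTransform.fourierInv_fourier_eq]⟩
  have hφ : Integrable φ := φ.integrable
  have hφ2 : MemLp φ 2 volume := φ.memLp 2 volume
  refine h.le_frameSum hΓ hΩ hgen hg2 (ψ.memLp 2 volume)
    (h.ae_windowSum_eq hΓ hΩ (ψ.memLp 2 volume) hD hDt ?_)
  rw [← hψ, setLIntegral_windowSum hD hΩ.isCompact.measurableSet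
    (measurable_energy_fourierInv hφ hg), lintegral_energy_fourierInv hφ hφ2 hg,
    eLpNorm_fourierInv hφ hφ2, eLpNorm_two_sq, ← lintegral_mul_const'' _ ?_,
    ← lintegral_mul_const'' _ ?_]
  · refine lintegral_congr_ae ?_
    filter_upwards [hae] with ξ hξ
    rw [← hξ]
    ring
  · exact hφ2.1.aemeasurable.enorm.pow_const 2
  · exact (hφ2.1.aemeasurable.enorm.pow_const 2).mul (measurable_tsum_fourier hg).aemeasurable

end Main

end ModelSetFrames

theorem theorem4p8 {m : ℕ} {K : Type*} [Countable K]
    (Γ : Submodule ℤ (EuclideanSpace ℝ (Fin m) × ℝ)) (Ω : Set ℝ)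
    (hsimple : ModelSetFrames.IsSimple Γ Ω)
    (hgeneric : ModelSetFrames.IsGeneric Γ Ω)
    (hsymm : ∀ x ∈ Ω, -x ∈ Ω)
    (g : K → EuclideanSpace ℝ (Fin m) → ℂ)
    (hg : ∀ k, ModelSetFrames.MemAmalgamOne 2 (g k)) :
    ModelSetFrames.HasDensity (ModelSetFrames.modelSet Γ Ω)
        (ModelSetFrames.density (ModelSetFrames.modelSet Γ Ω)) ∧
      (ModelSetFrames.IsNormalizedTightFrame g (ModelSetFrames.modelSet Γ Ω) ↔
        ModelSetFrames.IsBessel g (ModelSetFrames.modelSet Γ Ω) 1 ∧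
          ∀ᵐ t : EuclideanSpace ℝ (Fin m),
            ENNReal.ofReal (ModelSetFrames.density (ModelSetFrames.modelSet Γ Ω)) *
              ∑' k, ‖𝓕 (g k) t‖ₑ ^ 2 = 1) := by
  obtain ⟨a, b, hab, rfl⟩ := hsimple.exists_eq_Icc
  have hΓ := hsimple.lattice
  obtain ⟨D, hD, hDm, hDb, hD0, hDt⟩ := hΓ.exists_fundamentalDomain
  have hdens := hΓ.hasDensity_Icc hD hDm hDb hD0 hDt hab
  have hg1 := fun k => (hg k).integrable
  have hg2 := fun k => (hg k).memLp
  rw [hdens.density_eq]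
  have hval : ENNReal.ofReal ((b - a) / (volume D).toReal) =
      volume (Set.Icc a b) / volume D := by
    rw [ENNReal.ofReal_div_of_pos (ENNReal.toReal_pos hD0 hDt), ENNReal.ofReal_toReal hDt,
      Real.volume_Icc]
  -- Since `volume D` is neither zero nor infinite, the covolume can be cleared even if `S = ∞`.
  have hiff : ∀ S : ℝ≥0∞, ENNReal.ofReal ((b - a) / (volume D).toReal) * S = 1 ↔
      volume (Set.Icc a b) * S = volume D := by
    intro S
    rw [hval, ENNReal.div_eq_inv_mul, mul_assoc, ← ENNReal.div_eq_inv_mul,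
      ENNReal.div_eq_one_iff hD0 hDt]
  simp only [hiff]
  refine ⟨hdens, fun h => ⟨h.2.2.1, h.ae_tsum_fourier_eq hΓ hsimple.window hg1 hD⟩, fun h => ?_⟩
  exact h.1.isNormalizedTightFrame hΓ hsimple.window hgeneric hg1 hg2 hD hDt h.2
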